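/- **Setting.** Let $\mathcal L_=$ be the first-order language of equality and $\mathcal L_=^{\Diamond}$ its first-order modal expansion (formulas built from equalities using Boolean connectives, quantifiers, $\Diamond$ and $\Box$). In the category $\mathrm{Sets}[\twoheadrightarrow]$ of sets and surjective functions, satisfaction $W\models\varphi[\nu]$ of an $\mathcal L_=^{\Diamond}$-formula at a set (world) $W$ under an assignment $\nu$ is given by the usual Tarskian clauses together with: $W\models\Diamond\varphi[\nu]$ iff there are a set $U$ and a surjection $f:W\to U$ with $U\models\varphi[f\circ\nu]$; and $W\models\Box\varphi[\nu]$ iff $U\models\varphi[f\circ\nu]$ for every set $U$ and every surjection $f:W\to U$. A propositional modal assertion $\varphi(p_0,\dots,p_k)$ is *valid at $W$ with respect to sentential substitution instances from $\mathscr L$* if $W\models\varphi(\psi_0,\dots,\psi_k)$ for all sentences $\psi_0,\dots,\psi_k$ of $\mathscr L$. Let $\mathrm{Val}_{\mathrm{Sets}[\twoheadrightarrow]}(W,\mathscr L)$ be the set of all such assertions. A propositional modal theory is *normal* if it contains all propositional tautologies, $\Box(p\to q)\to(\Box p\to\Box q)$ and $\neg\Diamond p\leftrightarrow\Box\neg p$,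 and is closed under modus ponens, uniform substitution and necessitation. For $n\ge 1$ define $J_1:=\Diamond\Box p_1\to p_1$ and $J_{n+1}:=\Diamond(\Box p_{n+1}\wedge\neg J_n)\to p_{n+1}$. Let $\mathrm{Grz.3J}_n$ be the smallest normal theory containing - $\Box p\to p$, - $\Box p\to\Box\Box p$, - $\Box(\Box p\to q)\vee\Box(\Box q\to p)$, - $\Box(\Box(p\to\Box p)\to p)\to p$, and - $J_n$. **Theorem.** Let $n>0$ be a natural number and let $W$ be a set with exactly $n$ elements. For every first-order language $\mathscr L$, modal or not, with $\mathcal L_=\subseteq\mathscr L\subseteq\mathcal L_=^{\Diamond}$, $$\mathrm{Val}_{\mathrm{Sets}[\twoheadrightarrow]}(W,\mathscr L)=\mathrm{Grz.3J}_n .$$ -/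

import Mathlib

open scoped FirstOrder

universe u

/-! ## Propositional modal logic -/

/-- Propositional modal assertions over the variables `p_0, p_1, …`. Both modal operators are
primitive; the Boolean connectives are generated by falsum and implication. -/
inductive PropModal : Type
  | var : ℕ → PropModal
  | bot : PropModal
  | imp : PropModal → PropModal → PropModal
  | box : PropModal → PropModal
  | dia : PropModal → PropModal

namespace PropModal

/-- Negation. -/
def neg (φ : PropModal) : PropModal := imp φ bot

/-- Conjunction. -/
def and (φ ψ : PropModal) : PropModal := neg (imp φ (neg ψ))

/-- Disjunction. -/
def or (φ ψ : PropModal) : PropModal := imp (neg φ) ψ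

/-- Biconditional. -/
def iff (φ ψ : PropModal) : PropModal := and (imp φ ψ) (imp ψ φ)

/-- Uniform substitution of propositional modal assertions for the variables. -/
def subst (s : ℕ → PropModal) : PropModal → PropModal
  | var i => s i
  | bot => bot
  | imp φ ψ => imp (subst s φ) (subst s ψ)
  | box φ => box (subst s φ)
  | dia φ => dia (subst s φ)

/-- The truth value of an assertion when its propositional variables and its maximal subassertions
that begin with a modal operator are treated as propositional atoms with truth values given
by `v`. -/
def BoolEval (v : PropModal → Prop) : PropModal → Prop
  | var i => v (var i)
  | bot => False
  | imp φ ψ => BoolEval v φ → BoolEval v ψ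
  | box φ => v (box φ)
  | dia φ => v (dia φ)

/-- Propositional tautologies (in the modal language). -/
def IsTautology (φ : PropModal) : Prop := ∀ v : PropModal → Prop, BoolEval v φ

/-- `□(p → q) → (□p → □q)` -/
def axK : PropModal :=
  imp (box (imp (var 0) (var 1))) (imp (box (var 0)) (box (var 1)))

/-- `¬◇p ↔ □¬p` -/
def axDual : PropModal := iff (neg (dia (var 0))) (box (neg (var 0)))

/-- `□p → p` -/
def axT : PropModal := imp (box (var 0)) (var 0)

/-- `□p → □□p` -/
def ax4 : PropModal := imp (box (var 0)) (box (box (var 0)))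

/-- `□(□p → q) ∨ □(□q → p)` -/
def axDot3 : PropModal :=
  or (box (imp (box (var 0)) (var 1))) (box (imp (box (var 1)) (var 0)))

/-- `□(□(p → □p) → p) → p` -/
def axGrz : PropModal :=
  imp (box (imp (box (imp (var 0) (box (var 0)))) (var 0))) (var 0)

/-- The axioms `J_n` for `n ≥ 1`: `J_1` is `◇□p_1 → p_1`, and `J_{n+1}` is
`◇(□p_{n+1} ∧ ¬J_n) → p_{n+1}`. The value at `0` is only a convention. -/
def axJ : ℕ → PropModal
  | 0 => bot
  | 1 => imp (dia (box (var 1))) (var 1)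
  | n + 2 => imp (dia (and (box (var (n + 2))) (neg (axJ (n + 1))))) (var (n + 2))

/-- Normal propositional modal theories. -/
structure IsNormal (T : Set PropModal) : Prop where
  taut : ∀ φ, IsTautology φ → φ ∈ T
  memK : axK ∈ T
  memDual : axDual ∈ T
  modusPonens : ∀ φ ψ, imp φ ψ ∈ T → φ ∈ T → ψ ∈ T
  substitution : ∀ (s : ℕ → PropModal) (φ), φ ∈ T → subst s φ ∈ T
  necessitation : ∀ φ, φ ∈ T → box φ ∈ T

/-- The smallest normal propositional modal theory containing a given set of assertions. -/
def normalClosure (A : Set PropModal) : Set PropModal :=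
  ⋂₀ {T | IsNormal T ∧ A ⊆ T}

/-- The theory `K`. -/
def theoryK : Set PropModal := normalClosure ∅

/-- `S4 = K + T + 4`. -/
def theoryS4 : Set PropModal := normalClosure (theoryK ∪ {axT, ax4})

/-- `S4.3 = S4 + .3`. -/
def theoryS43 : Set PropModal := normalClosure (theoryS4 ∪ {axDot3})

/-- `Grz.3 = S4.3 + Grz`. -/
def theoryGrz3 : Set PropModal := normalClosure (theoryS43 ∪ {axGrz})

/-- `Grz.3J_n = Grz.3 + J_n` (for `n ≥ 1`). -/
def theoryGrz3J (n : ℕ) : Set PropModal := normalClosure (theoryGrz3 ∪ {axJ n})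

end PropModal

/-! ## First-order modal logic and Kripke categories -/

/-- Formulas of the first-order modal expansion of a first-order language `L`: Mathlib's bounded
formulas together with the two modal operators. The free variables are indexed by `α` (named
variables) and by `Fin n` (de Bruijn variables). -/
inductive ModalFormula (L : FirstOrder.Language.{0, 0}) (α : Type) : ℕ → Type
  | falsum {n : ℕ} : ModalFormula L α n
  | equal {n : ℕ} (t₁ t₂ : L.Term (α ⊕ Fin n)) : ModalFormula L α n
  | rel {n l : ℕ} (R : L.Relations l) (ts : Fin l → L.Term (α ⊕ Fin n)) : ModalFormula L α n
  | imp {n : ℕ} (φ ψ : ModalFormula L α n) : ModalFormula L α n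
  | all {n : ℕ} (φ : ModalFormula L α (n + 1)) : ModalFormula L α n
  | box {n : ℕ} (φ : ModalFormula L α n) : ModalFormula L α n
  | dia {n : ℕ} (φ : ModalFormula L α n) : ModalFormula L α n

/-- Sentences of the first-order modal expansion of `L`. -/
abbrev ModalSentence (L : FirstOrder.Language.{0, 0}) : Type := ModalFormula L Empty 0

/-- Every ordinary first-order formula is a (modality-free) formula of the modal expansion. -/
def ModalFormula.ofFormula {L : FirstOrder.Language.{0, 0}} {α : Type} :
    {n : ℕ} → L.BoundedFormula α n → ModalFormula L α n
  | _, .falsum => .falsum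
  | _, .equal t₁ t₂ => .equal t₁ t₂
  | _, .rel R ts => .rel R ts
  | _, .imp φ ψ => .imp (ofFormula φ) (ofFormula ψ)
  | _, .all φ => .all (ofFormula φ)

/-- A Kripke category: a concrete category of `L`-structures. Its objects, the worlds, are
`L`-structures, and its morphisms, the accessibility mappings, are `L`-homomorphisms. -/
structure KripkeCategory (L : FirstOrder.Language.{0, 0}) where
  World : Type (u + 1)
  carrier : World → Type u
  str : ∀ W : World, L.Structure (carrier W)
  Acc : ∀ W U : World, Set (carrier W →[L] carrier U)
  id_mem : ∀ W : World, FirstOrder.Language.Hom.id L (carrier W) ∈ Acc W W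
  comp_mem : ∀ {W U V : World} (g : carrier U →[L] carrier V) (f : carrier W →[L] carrier U),
    g ∈ Acc U V → f ∈ Acc W U → g.comp f ∈ Acc W V

attribute [instance] KripkeCategory.str

namespace KripkeCategory

variable {L : FirstOrder.Language.{0, 0}}

/-- Satisfaction `W ⊨ φ[ν]` in a Kripke category; the assignment `ν` consists of `v` and `xs`. -/
def Sat (C : KripkeCategory.{u} L) {α : Type} : {n : ℕ} → ModalFormula L α n →
    (W : C.World) → (α → C.carrier W) → (Fin n → C.carrier W) → Prop
  | _, .falsum, _, _, _ => False
  | _, .equal t₁ t₂, _, v, xs => t₁.realize (Sum.elim v xs) = t₂.realize (Sum.elim v xs)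
  | _, .rel R ts, _, v, xs =>
      FirstOrder.Language.Structure.RelMap R fun i => (ts i).realize (Sum.elim v xs)
  | _, .imp φ ψ, W, v, xs => Sat C φ W v xs → Sat C ψ W v xs
  | _, .all φ, W, v, xs => ∀ a : C.carrier W, Sat C φ W v (Fin.snoc xs a)
  | _, .box φ, W, v, xs => ∀ (U : C.World), ∀ f ∈ C.Acc W U, Sat C φ U (f ∘ v) (f ∘ xs)
  | _, .dia φ, W, v, xs => ∃ (U : C.World), ∃ f ∈ C.Acc W U, Sat C φ U (f ∘ v) (f ∘ xs)

/-- Truth of a sentence at a world. -/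
def Truth (C : KripkeCategory.{u} L) (W : C.World) (φ : ModalSentence L) : Prop :=
  C.Sat φ W Empty.elim Fin.elim0

end KripkeCategory

/-- A language of substitution instances within the modal expansion of `L`: for each `n`, the set of
those of its formulas whose free variables are among `x_0, …, x_{n-1}`. -/
abbrev SubstLanguage (L : FirstOrder.Language.{0, 0}) : Type := ∀ n : ℕ, Set (ModalFormula L Empty n)

namespace SubstLanguage

/-- The non-modal first-order language `L` itself. -/
def nonmodal (L : FirstOrder.Language.{0, 0}) : SubstLanguage L := fun _ => Set.range ModalFormula.ofFormula

/-- The full modal expansion of `L`. -/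
def modal (L : FirstOrder.Language.{0, 0}) : SubstLanguage L := fun _ => Set.univ

end SubstLanguage

/-- The substitution instance `φ(ψ_0, ψ_1, …)` of a propositional modal assertion `φ`, in which the
sentences `ψ_i` replace the propositional variables `p_i`. -/
def PropModal.instantiate {L : FirstOrder.Language.{0, 0}} (ψ : ℕ → ModalSentence L) :
    PropModal → ModalSentence L
  | .var i => ψ i
  | .bot => .falsum
  | .imp φ χ => .imp (instantiate ψ φ) (instantiate ψ χ)
  | .box φ => .box (instantiate ψ φ)
  | .dia φ => .dia (instantiate ψ φ)

/-- The propositional modal assertions that are valid at the world `W` of the Kripke category `C`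
with respect to sentential substitution instances from the language `S`. -/
def KripkeCategory.sententialVal {L : FirstOrder.Language.{0, 0}} (C : KripkeCategory.{u} L) (W : C.World)
    (S : SubstLanguage L) : Set PropModal :=
  {φ | ∀ ψ : ℕ → ModalSentence L, (∀ i, ψ i ∈ S 0) → C.Truth W (φ.instantiate ψ)}

/-- The Kripke category of sets and surjective functions, in the language of equality (Mathlib's
first-order language without function and relation symbols; equality is a logical symbol). -/
def setsSurj : KripkeCategory.{u} FirstOrder.Language.empty where
  World := Type u
  carrier W := W
  str _ := FirstOrder.Language.emptyStructure
  Acc W U := letI (X : Type u) : FirstOrder.Language.empty.Structure X :=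
      FirstOrder.Language.emptyStructure
    {f : W →[FirstOrder.Language.empty] U | Function.Surjective f}
  id_mem _ := Function.surjective_id
  comp_mem _ _ hg hf := hg.comp hf

/-!
The truth of a modal sentence of equality at a set depends only on the cardinality of the set, and
the surjective images of a set with `j + 1` elements are the sets with `i + 1` elements for
`i ≤ j`, up to bijection. Hence a set with `m + 1` elements behaves like the world `m` of the Kripke
model with worlds `0, 1, 2, …` in which `j` accesses every `i ≤ j` (`setTruth_instantiate_iff`). Since
the number of elements can be expressed in the language of equality up to any finite bound, every
valuation on the worlds `0, …, m` arises from non-modal sentences (`exists_sentence_of_card`). So the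
valid assertions are those true at the world `m` of this chain under every valuation, whatever the
language of substitution instances is, and what remains is the soundness and completeness of
`Grz.3J_{m+1}` for the chain with `m + 1` worlds.

Completeness uses the canonical model, whose points are the maximal theories. Axiom `.3` makes the
points accessible from a given one linearly preordered, and `J_{m+1}` bounds the length of strict
chains: going strictly up from a point that contains all instances of `J_{k+1}` leads to a point that
contains all instances of `J_k` (`HasRank.of_strict`). The Grzegorczyk axiom gives that, if `□ψ` fails
at a point, then `ψ` fails throughout the cluster of some accessible point
(`IsMaximalTheory.exists_cluster_notMem`). For that reason one arbitrary point of each cluster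
suffices: if `y` is an immediate strict successor of `x`, then `□ψ ∈ x` iff `ψ ∈ x` and `□ψ ∈ y`, which
is the recursion that evaluates `□` on the chain (`exists_valuation`).
-/

namespace PropModal

/-! ### Evaluation on the chain of natural numbers -/

/-- Truth of an assertion at a world of the Kripke model whose worlds are the natural numbers, where
`j` accesses exactly the `i ≤ j`; here `V j p` is the truth value of the variable `p` at `j`. -/
def ChainEval (V : ℕ → ℕ → Prop) : PropModal → ℕ → Prop
  | var p, j => V j p
  | bot, _ => False
  | imp φ ψ, j => ChainEval V φ j → ChainEval V ψ j
  | box φ, j => ∀ i ≤ j, ChainEval V φ i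
  | dia φ, j => ∃ i ≤ j, ChainEval V φ i

theorem chainEval_and {V : ℕ → ℕ → Prop} {φ ψ : PropModal} {j : ℕ} :
    ChainEval V (and φ ψ) j ↔ ChainEval V φ j ∧ ChainEval V ψ j := by
  simp only [and, neg, ChainEval]
  tauto

theorem chainEval_subst (V : ℕ → ℕ → Prop) (s : ℕ → PropModal) (φ : PropModal) (j : ℕ) :
    ChainEval V (subst s φ) j ↔ ChainEval (fun i p => ChainEval V (s p) i) φ j := by
  induction φ generalizing j with
  | var p => rfl
  | bot => rfl
  | imp φ ψ ihφ ihψ => simp only [subst, ChainEval, ihφ, ihψ]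
  | box φ ih => simp only [subst, ChainEval, ih]
  | dia φ ih => simp only [subst, ChainEval, ih]

theorem chainEval_congr {V V' : ℕ → ℕ → Prop} (φ : PropModal) {j : ℕ}
    (h : ∀ i ≤ j, V i = V' i) : ChainEval V φ j ↔ ChainEval V' φ j := by
  induction φ generalizing j with
  | var p => simp only [ChainEval, h j le_rfl]
  | bot => rfl
  | imp φ ψ ihφ ihψ => simp only [ChainEval, ihφ h, ihψ h]
  | box φ ih => exact forall₂_congr fun i hi => ih fun k hk => h k (hk.trans hi)
  | dia φ ih =>
    exact exists_congr fun i => and_congr_right fun hi => ih fun k hk => h k (hk.trans hi)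

theorem chainEval_iff_boolEval (V : ℕ → ℕ → Prop) (φ : PropModal) (j : ℕ) :
    ChainEval V φ j ↔ BoolEval (fun ψ => ChainEval V ψ j) φ := by
  induction φ with
  | imp φ ψ ihφ ihψ => simp only [ChainEval, BoolEval, ihφ, ihψ]
  | _ => rfl

/-- The assertions true at all worlds `j ≤ m` of the chain under all valuations. -/
def chainLogic (m : ℕ) : Set PropModal := {φ | ∀ V, ∀ j ≤ m, ChainEval V φ j}

theorem isNormal_chainLogic (m : ℕ) : IsNormal (chainLogic m) where
  taut φ h V j _ := (chainEval_iff_boolEval V φ j).2 (h _)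
  memK _ _ _ h h' i hi := h i hi (h' i hi)
  memDual V j _ := by
    simp only [axDual, iff, chainEval_and, ChainEval, neg, imp_false, not_exists, not_and]
    exact ⟨id, id⟩
  modusPonens _ _ h h' V j hj := h V j hj (h' V j hj)
  substitution s φ h V j hj := (chainEval_subst V s φ j).2 (h _ j hj)
  necessitation _ h V _ hj i hi := h V i (hi.trans hj)

theorem axDot3_mem_chainLogic (m : ℕ) : axDot3 ∈ chainLogic m := by
  intro V j _ h i hi hi1
  by_contra hi0
  refine h fun k hk hk0 => ?_
  rcases le_total i k with hik | hki
  · exact absurd (hk0 i hik) hi0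
  · exact hi1 k hki

theorem axGrz_mem_chainLogic (m : ℕ) : axGrz ∈ chainLogic m := by
  intro V j _ h
  -- By strong induction the variable holds at every `i ≤ j`, starting from the last world `0`.
  suffices ∀ i ≤ j, ChainEval V (var 0) i from this j le_rfl
  intro i
  induction i using Nat.strong_induction_on with
  | _ i ih =>
    intro hi
    by_contra hn
    refine hn (h i hi fun k hk hk0 l hl => ?_)
    have hki : k < i := lt_of_le_of_ne hk fun e => hn (e ▸ hk0)
    exact ih l (hl.trans_lt hki) ((hl.trans hk).trans hi)

theorem axJ_mem_chainLogic (m : ℕ) : axJ (m + 1) ∈ chainLogic m := by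
  intro V
  induction m with
  | zero =>
    rintro j hj ⟨i, hi, h⟩
    exact h j (by omega)
  | succ m ih =>
    rintro j hj ⟨i, hi, h⟩
    obtain ⟨hb, hn⟩ := chainEval_and.1 h
    rcases hi.eq_or_lt with rfl | hlt
    · exact hb i le_rfl
    · exact absurd (ih i (by omega)) hn

/-! ### Normal closures -/

theorem isNormal_normalClosure (A : Set PropModal) : IsNormal (normalClosure A) where
  taut φ h _ hT := hT.1.taut φ h
  memK _ hT := hT.1.memK
  memDual _ hT := hT.1.memDual
  modusPonens φ ψ h h' T hT := hT.1.modusPonens φ ψ (h T hT) (h' T hT)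
  substitution s φ h T hT := hT.1.substitution s φ (h T hT)
  necessitation φ h T hT := hT.1.necessitation φ (h T hT)

theorem subset_normalClosure (A : Set PropModal) : A ⊆ normalClosure A :=
  fun _ h _ hT => hT.2 h

theorem normalClosure_subset {A T : Set PropModal} (hT : IsNormal T) (h : A ⊆ T) :
    normalClosure A ⊆ T := fun _ hφ => hφ T ⟨hT, h⟩

theorem theoryGrz3_subset_theoryGrz3J (n : ℕ) : theoryGrz3 ⊆ theoryGrz3J n :=
  Set.subset_union_left.trans (subset_normalClosure _)

theorem theoryS43_subset_theoryGrz3J (n : ℕ) : theoryS43 ⊆ theoryGrz3J n :=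
  (Set.subset_union_left.trans (subset_normalClosure _)).trans (theoryGrz3_subset_theoryGrz3J n)

theorem theoryS4_subset_theoryGrz3J (n : ℕ) : theoryS4 ⊆ theoryGrz3J n :=
  (Set.subset_union_left.trans (subset_normalClosure _)).trans (theoryS43_subset_theoryGrz3J n)

theorem theoryGrz3J_subset_chainLogic (m : ℕ) : theoryGrz3J (m + 1) ⊆ chainLogic m := by
  have hN := isNormal_chainLogic m
  refine normalClosure_subset hN (Set.union_subset (normalClosure_subset hN (Set.union_subset
    (normalClosure_subset hN (Set.union_subset (normalClosure_subset hN (Set.union_subset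
    (normalClosure_subset hN (Set.empty_subset _)) ?_)) ?_)) ?_)) ?_)
  · rintro φ (rfl | rfl)
    · exact fun V j _ h => h j le_rfl
    · exact fun V j _ h i hi k hk => h k (hk.trans hi)
  · rintro φ rfl
    exact axDot3_mem_chainLogic m
  · rintro φ rfl
    exact axGrz_mem_chainLogic m
  · rintro φ rfl
    exact axJ_mem_chainLogic m

/-! ### Derivations and maximal theories -/

/-- Derivability from the theory `T` and the hypotheses `Γ` by modus ponens alone. -/
inductive Deriv (T Γ : Set PropModal) : PropModal → Prop
  | thm {φ} : φ ∈ T → Deriv T Γ φ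
  | hyp {φ} : φ ∈ Γ → Deriv T Γ φ
  | mp {φ ψ} : Deriv T Γ (imp φ ψ) → Deriv T Γ φ → Deriv T Γ ψ

theorem Deriv.mono {T Γ Δ : Set PropModal} {φ : PropModal} (h : Deriv T Γ φ) (hΓ : Γ ⊆ Δ) :
    Deriv T Δ φ := by
  induction h with
  | thm h => exact .thm h
  | hyp h => exact .hyp (hΓ h)
  | mp _ _ ih ih' => exact ih.mp ih'

theorem Deriv.deduction {T : Set PropModal} (hT : IsNormal T) {Γ : Set PropModal}
    {φ ψ : PropModal} (h : Deriv T (insert φ Γ) ψ) : Deriv T Γ (imp φ ψ) := by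
  induction h with
  | @thm χ h => exact .mp (.thm (hT.taut (imp χ (imp φ χ)) fun _ h _ => h)) (.thm h)
  | @hyp χ h =>
    rcases h with rfl | h
    · exact .thm (hT.taut (imp χ χ) fun _ h => h)
    · exact .mp (.thm (hT.taut (imp χ (imp φ χ)) fun _ h _ => h)) (.hyp h)
  | @mp χ θ _ _ ih ih' =>
    exact .mp (.mp (.thm (hT.taut (imp (imp φ (imp χ θ)) (imp (imp φ χ) (imp φ θ)))
      fun _ h h' h'' => h h'' (h' h''))) ih) ih'

theorem Deriv.of_sUnion {T : Set PropModal} {c : Set (Set PropModal)} (hc : IsChain (· ⊆ ·) c)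
    (hne : c.Nonempty) {φ : PropModal} (h : Deriv T (⋃₀ c) φ) : ∃ Γ ∈ c, Deriv T Γ φ := by
  induction h with
  | thm h => exact ⟨_, hne.some_mem, .thm h⟩
  | hyp h =>
    obtain ⟨Γ, hΓ, h⟩ := h
    exact ⟨Γ, hΓ, .hyp h⟩
  | mp _ _ ih ih' =>
    obtain ⟨Γ, hΓ, h⟩ := ih
    obtain ⟨Δ, hΔ, h'⟩ := ih'
    rcases hc.total hΓ hΔ with hs | hs
    · exact ⟨Δ, hΔ, (h.mono hs).mp h'⟩
    · exact ⟨Γ, hΓ, h.mp (h'.mono hs)⟩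

/-- The points of the canonical model of `T`: the maximal consistent extensions of `T`, described by
their behaviour on the connectives `⊥` and `→`. -/
structure IsMaximalTheory (T x : Set PropModal) : Prop where
  subset : T ⊆ x
  bot_notMem : bot ∉ x
  imp_mem_iff : ∀ φ ψ, imp φ ψ ∈ x ↔ (φ ∈ x → ψ ∈ x)

/-- Lindenbaum's lemma. -/
theorem exists_isMaximalTheory {T : Set PropModal} (hT : IsNormal T) {Γ : Set PropModal}
    {φ : PropModal} (h : ¬ Deriv T Γ φ) : ∃ x, IsMaximalTheory T x ∧ Γ ⊆ x ∧ φ ∉ x := by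
  obtain ⟨x, hΓx, hx⟩ := zorn_subset_nonempty {Δ | ¬ Deriv T Δ φ}
    (fun c hc hchain hne => ⟨⋃₀ c, fun hd => by
      obtain ⟨Δ, hΔ, hd⟩ := hd.of_sUnion hchain hne
      exact hc hΔ hd, fun Δ hΔ => Set.subset_sUnion_of_mem hΔ⟩) Γ h
  have hxφ : ¬ Deriv T x φ := hx.prop
  -- Maximality among the sets that do not derive `φ` makes every non-member of `x` imply `φ`.
  have himp : ∀ ψ, ψ ∉ x → Deriv T x (imp ψ φ) := fun ψ hψ => by
    by_contra hn
    exact hψ (hx.le_of_ge (y := insert ψ x) (fun hd => hn (hd.deduction hT))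
      (Set.subset_insert _ _) (Set.mem_insert _ _))
  have hclosed : ∀ ψ, Deriv T x ψ → ψ ∈ x := fun ψ hψ => by
    by_contra hn
    exact hxφ ((himp ψ hn).mp hψ)
  refine ⟨x, ⟨fun ψ hψ => hclosed ψ (.thm hψ), fun hb => hxφ ?_, fun ψ χ => ⟨fun h h' =>
    hclosed _ (.mp (.hyp h) (.hyp h')), fun h => ?_⟩⟩, hΓx, fun h => hxφ (.hyp h)⟩
  · exact .mp (.thm (hT.taut (imp bot φ) fun _ h => h.elim)) (.hyp hb)
  · by_cases hψ : ψ ∈ x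
    · exact hclosed _ (.mp (.thm (hT.taut (imp χ (imp ψ χ)) fun _ h _ => h)) (.hyp (h hψ)))
    · by_contra hn
      -- Both `ψ → χ` and `ψ` imply `φ`, and one of them holds classically.
      refine hxφ (.mp (.mp (.thm (hT.taut (imp (imp (imp ψ χ) φ) (imp (imp ψ φ) φ)) ?_))
        (himp _ hn)) (himp _ hψ))
      intro v
      simp only [BoolEval]
      tauto

/-! ### The canonical model -/

/-- Accessibility in the canonical model. -/
def CanAcc (x y : Set PropModal) : Prop := ∀ φ, box φ ∈ x → φ ∈ y

namespace IsMaximalTheory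

variable {T x y : Set PropModal}

theorem neg_mem_iff (hx : IsMaximalTheory T x) (φ : PropModal) : neg φ ∈ x ↔ φ ∉ x := by
  rw [neg, hx.imp_mem_iff]
  exact ⟨fun h h' => hx.bot_notMem (h h'), fun h h' => absurd h' h⟩

theorem and_mem_iff (hx : IsMaximalTheory T x) (φ ψ : PropModal) :
    and φ ψ ∈ x ↔ φ ∈ x ∧ ψ ∈ x := by
  rw [and, hx.neg_mem_iff, hx.imp_mem_iff, hx.neg_mem_iff]
  tauto

theorem box_imp_box (hx : IsMaximalTheory T x) (hT : IsNormal T) {φ ψ : PropModal}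
    (h : box (imp φ ψ) ∈ x) (h' : box φ ∈ x) : box ψ ∈ x := by
  have hK : imp (box (imp φ ψ)) (imp (box φ) (box ψ)) ∈ T :=
    hT.substitution (fun | 0 => φ | _ => ψ) _ hT.memK
  exact (hx.imp_mem_iff _ _).1 ((hx.imp_mem_iff _ _).1 (hx.subset hK) h) h'

theorem dia_mem_iff (hx : IsMaximalTheory T x) (hT : IsNormal T) (φ : PropModal) :
    dia φ ∈ x ↔ box (neg φ) ∉ x := by
  have hD : iff (neg (dia φ)) (box (neg φ)) ∈ x :=
    hx.subset (hT.substitution (fun _ => φ) _ hT.memDual)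
  rw [iff, hx.and_mem_iff, hx.imp_mem_iff, hx.imp_mem_iff, hx.neg_mem_iff] at hD
  tauto

theorem exists_of_box_notMem (hx : IsMaximalTheory T x) (hT : IsNormal T) {φ : PropModal}
    (h : box φ ∉ x) : ∃ y, IsMaximalTheory T y ∧ CanAcc x y ∧ φ ∉ y := by
  refine exists_isMaximalTheory hT (Γ := {ψ | box ψ ∈ x}) fun hd => h ?_
  clear h
  induction hd with
  | thm h => exact hx.subset (hT.necessitation _ h)
  | hyp h => exact h
  | mp _ _ ih ih' => exact hx.box_imp_box hT ih ih'

theorem dia_mem (hx : IsMaximalTheory T x) (hT : IsNormal T) (hy : IsMaximalTheory T y)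
    (hxy : CanAcc x y) {φ : PropModal} (h : φ ∈ y) : dia φ ∈ x :=
  (hx.dia_mem_iff hT φ).2 fun hb => (hy.neg_mem_iff φ).1 (hxy _ hb) h

end IsMaximalTheory

/-! ### Linear order and clusters -/

section Grz3

variable {T x y z : Set PropModal}

theorem CanAcc.refl (hT : IsNormal T) (hA : axT ∈ T) (hx : IsMaximalTheory T x) :
    CanAcc x x := fun φ =>
  (hx.imp_mem_iff _ _).1 (hx.subset (hT.substitution (fun _ => φ) _ hA))

theorem CanAcc.box_mem (hT : IsNormal T) (hA : ax4 ∈ T) (hx : IsMaximalTheory T x)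
    (hxy : CanAcc x y) {φ : PropModal} (h : box φ ∈ x) : box φ ∈ y :=
  hxy _ ((hx.imp_mem_iff _ _).1 (hx.subset (hT.substitution (fun _ => φ) _ hA)) h)

theorem CanAcc.trans (hT : IsNormal T) (hA : ax4 ∈ T) (hx : IsMaximalTheory T x)
    (hxy : CanAcc x y) (hyz : CanAcc y z) : CanAcc x z :=
  fun _ h => hyz _ (hxy.box_mem hT hA hx h)

theorem CanAcc.total (hT : IsNormal T) (hA : axDot3 ∈ T) (hx : IsMaximalTheory T x)
    (hy : IsMaximalTheory T y) (hz : IsMaximalTheory T z) (hxy : CanAcc x y) (hxz : CanAcc x z) :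
    CanAcc y z ∨ CanAcc z y := by
  by_contra! hn
  simp only [CanAcc, not_forall] at hn
  obtain ⟨⟨φ, hφy, hφz⟩, ψ, hψz, hψy⟩ := hn
  have h3 : or (box (imp (box φ) ψ)) (box (imp (box ψ) φ)) ∈ x :=
    hx.subset (hT.substitution (fun | 0 => φ | _ => ψ) _ hA)
  rw [or, hx.imp_mem_iff, hx.neg_mem_iff] at h3
  by_cases h : box (imp (box φ) ψ) ∈ x
  · exact hψy ((hy.imp_mem_iff _ _).1 (hxy _ h) hφy)
  · exact hφz ((hz.imp_mem_iff _ _).1 (hxz _ (h3 h)) hψz)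

/-- By the Grzegorczyk axiom, if `□φ` fails at `x` then `φ` fails at some accessible point together
with its whole cluster, namely at one that contains `□(φ → □φ)` and not `φ`. -/
theorem IsMaximalTheory.exists_cluster_notMem (hT : IsNormal T) (h4 : ax4 ∈ T) (hG : axGrz ∈ T)
    (hx : IsMaximalTheory T x) {φ : PropModal} (h : box φ ∉ x) :
    ∃ y, IsMaximalTheory T y ∧ CanAcc x y ∧
      ∀ z, IsMaximalTheory T z → CanAcc y z → CanAcc z y → φ ∉ z := by
  obtain ⟨w, hw, hxw, hφw⟩ := hx.exists_of_box_notMem hT h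
  have hg : imp (box (imp (box (imp φ (box φ))) φ)) φ ∈ w :=
    hw.subset (hT.substitution (fun _ => φ) _ hG)
  obtain ⟨y, hy, hwy, hφy⟩ :=
    hw.exists_of_box_notMem hT fun hb => hφw ((hw.imp_mem_iff _ _).1 hg hb)
  rw [hy.imp_mem_iff, Classical.not_imp] at hφy
  refine ⟨y, hy, hxw.trans hT h4 hx hwy, fun z hz hyz hzy hφz => hφy.2 (hzy _ ?_)⟩
  exact (hz.imp_mem_iff _ _).1 (hyz _ hφy.1) hφz

/-! ### Ranks -/

theorem subst_axJ_congr {s t : ℕ → PropModal} (k : ℕ) (h : ∀ i ≤ k, s i = t i) :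
    subst s (axJ k) = subst t (axJ k) := by
  induction k with
  | zero => rfl
  | succ k ih =>
    cases k with
    | zero => simp only [axJ, subst, h 1 le_rfl]
    | succ k =>
      simp only [axJ, and, neg, subst, h (k + 2) le_rfl, ih fun i hi => h i (by omega)]

/-- The point `x` contains all instances of `J_k`, so that strict chains starting at `x` have at most
`k` points; for `k = 0` this never holds at a maximal theory, because `J_0` is `⊥`. -/
def HasRank (x : Set PropModal) (k : ℕ) : Prop := ∀ s, subst s (axJ k) ∈ x

theorem HasRank.of_strict (hT : IsNormal T) (hx : IsMaximalTheory T x) (hy : IsMaximalTheory T y)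
    (hxy : CanAcc x y) (hyx : ¬ CanAcc y x) {k : ℕ} (h : HasRank x (k + 1)) : HasRank y k := by
  simp only [CanAcc, not_forall] at hyx
  obtain ⟨φ, hφy, hφx⟩ := hyx
  cases k with
  | zero =>
    have hJ : imp (dia (box φ)) φ ∈ x := h fun _ => φ
    exact absurd ((hx.imp_mem_iff _ _).1 hJ (hx.dia_mem hT hy hxy hφy)) hφx
  | succ k =>
    intro s
    by_contra hn
    -- The variable `p_{k+2}` does not occur in `J_{k+1}`, so it may be given the value `φ`.
    have hs : subst (Function.update s (k + 2) φ) (axJ (k + 1)) = subst s (axJ (k + 1)) :=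
      subst_axJ_congr _ fun i hi => Function.update_of_ne (by omega) _ _
    have hJ := h (Function.update s (k + 2) φ)
    simp only [axJ, and, neg, subst, hs, Function.update_self] at hJ
    refine hφx ((hx.imp_mem_iff _ _).1 hJ (hx.dia_mem hT hy hxy ?_))
    exact (hy.and_mem_iff _ _).2 ⟨hφy, (hy.neg_mem_iff _).2 hn⟩

/-- The least rank decreases along strict accessibility, so a strict successor of `x` whose least rank
is as large as possible accesses all the others. -/
theorem exists_immediate_successor (hT : IsNormal T) (h3 : axDot3 ∈ T) {n : ℕ} (hJ : axJ n ∈ T)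
    (hx : IsMaximalTheory T x)
    (hne : ∃ y, IsMaximalTheory T y ∧ CanAcc x y ∧ ¬ CanAcc y x) :
    ∃ y, IsMaximalTheory T y ∧ CanAcc x y ∧ ¬ CanAcc y x ∧
      ∀ z, IsMaximalTheory T z → CanAcc x z → ¬ CanAcc z x → CanAcc y z := by
  classical
  have hr : ∀ y, IsMaximalTheory T y → HasRank y n := fun y hy s =>
    hy.subset (hT.substitution s _ hJ)
  obtain ⟨y, ⟨hy, hxy, hyx⟩, hmax⟩ := (measure fun y => n - sInf {k | HasRank y k}).wf.has_min
    {y | IsMaximalTheory T y ∧ CanAcc x y ∧ ¬ CanAcc y x} hne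
  refine ⟨y, hy, hxy, hyx, fun z hz hxz hzx => ?_⟩
  by_contra hyz
  have hzy : CanAcc z y := (CanAcc.total hT h3 hx hy hz hxy hxz).resolve_left hyz
  refine hmax z ⟨hz, hxz, hzx⟩ ?_
  have hzn : sInf {k | HasRank z k} ≤ n := Nat.sInf_le (hr z hz)
  have hzr : HasRank z (sInf {k | HasRank z k}) := Nat.sInf_mem (s := {k | HasRank z k}) ⟨n, hr z hz⟩
  obtain ⟨k, hk⟩ : ∃ k, sInf {k | HasRank z k} = k + 1 := by
    refine Nat.exists_eq_succ_of_ne_zero fun h0 => ?_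
    rw [h0] at hzr
    exact hz.bot_notMem (hzr var)
  rw [hk] at hzr
  have hyk : sInf {k | HasRank y k} ≤ k := Nat.sInf_le (hzr.of_strict hT hz hy hzy hyz)
  change n - sInf {k | HasRank z k} < n - sInf {k | HasRank y k}
  omega

/-! ### Completeness -/

/-- It suffices to match a valuation with a maximal theory on variables and on `□`. -/
theorem chainEval_iff_mem_of_box (hT : IsNormal T) (hx : IsMaximalTheory T x)
    {V : ℕ → ℕ → Prop} {j : ℕ} (hvar : ∀ p, V j p ↔ var p ∈ x)
    (hbox : ∀ φ, (ChainEval V φ j ↔ φ ∈ x) → (ChainEval V (box φ) j ↔ box φ ∈ x))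
    (φ : PropModal) : ChainEval V φ j ↔ φ ∈ x := by
  induction φ with
  | var p => exact hvar p
  | bot => exact iff_of_false id hx.bot_notMem
  | imp φ ψ ihφ ihψ => rw [hx.imp_mem_iff, ← ihφ, ← ihψ]; rfl
  | box φ ih => exact hbox φ ih
  | dia φ ih =>
    have h : ChainEval V (box (neg φ)) j ↔ box (neg φ) ∈ x :=
      hbox _ (by rw [hx.neg_mem_iff, ← ih]; rfl)
    rw [hx.dia_mem_iff hT, ← h]
    simp only [ChainEval, neg, imp_false, not_forall, not_not, exists_prop]

theorem chainEval_const (v : ℕ → Prop) (φ : PropModal) (j : ℕ) :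
    ChainEval (fun _ => v) φ j ↔ ChainEval (fun _ => v) φ 0 := by
  induction φ generalizing j with
  | var p => rfl
  | bot => rfl
  | imp φ ψ ihφ ihψ => exact imp_congr (ihφ j) (ihψ j)
  | box φ ih =>
    exact ⟨fun h i _ => (ih i).2 ((ih j).1 (h j le_rfl)), fun h i _ => (ih i).2 (h 0 le_rfl)⟩
  | dia φ ih =>
    exact ⟨fun ⟨i, _, h⟩ => ⟨0, le_rfl, (ih i).1 h⟩,
      fun ⟨i, _, h⟩ => ⟨j, le_rfl, (ih j).2 ((ih i).1 h)⟩⟩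

/-- At a point of a last cluster `□` is trivial, so that a constant valuation describes the point. -/
theorem chainEval_iff_mem_of_last (hT : IsNormal T) (hA : axT ∈ T) (h4 : ax4 ∈ T)
    (hG : axGrz ∈ T) (hx : IsMaximalTheory T x)
    (hlast : ∀ z, IsMaximalTheory T z → CanAcc x z → CanAcc z x) (m : ℕ) (φ : PropModal) :
    ChainEval (fun _ p => var p ∈ x) φ m ↔ φ ∈ x := by
  refine chainEval_iff_mem_of_box hT hx (fun _ => Iff.rfl) (fun φ ih => ?_) φ
  have hb : ChainEval (fun _ p => var p ∈ x) (box φ) m ↔ φ ∈ x := by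
    rw [← ih]
    refine ⟨fun h => h m le_rfl, fun h i _ => ?_⟩
    rw [chainEval_const] at h ⊢
    exact h
  rw [hb]
  refine ⟨fun h => ?_, CanAcc.refl hT hA hx φ⟩
  by_contra hn
  obtain ⟨z, hz, hxz, hzc⟩ := hx.exists_cluster_notMem hT h4 hG hn
  exact hzc x hx (hlast z hz hxz) hxz h

/-- A point with all instances of `J_{m+1}` has the same true assertions as the world `m` of the chain
under a suitable valuation. -/
theorem exists_valuation (hT : IsNormal T) (hA : axT ∈ T) (h4 : ax4 ∈ T) (h3 : axDot3 ∈ T)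
    (hG : axGrz ∈ T) {n : ℕ} (hJ : axJ n ∈ T) (m : ℕ) (hx : IsMaximalTheory T x)
    (hr : HasRank x (m + 1)) :
    ∃ V : ℕ → ℕ → Prop, ∀ φ, ChainEval V φ m ↔ φ ∈ x := by
  induction m generalizing x with
  | zero =>
    refine ⟨_, chainEval_iff_mem_of_last hT hA h4 hG hx (fun z hz hxz => ?_) 0⟩
    by_contra hzx
    exact hz.bot_notMem (hr.of_strict hT hx hz hxz hzx var)
  | succ m ih =>
    by_cases hne : ∃ y, IsMaximalTheory T y ∧ CanAcc x y ∧ ¬ CanAcc y x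
    · obtain ⟨y, hy, hxy, hyx, hsucc⟩ := exists_immediate_successor hT h3 hJ hx hne
      obtain ⟨V, hV⟩ := ih hy (hr.of_strict hT hx hy hxy hyx)
      let V' : ℕ → ℕ → Prop := Function.update V (m + 1) fun p => var p ∈ x
      have hVV' : ∀ i ≤ m, V' i = V i := fun i hi => Function.update_of_ne (by omega) _ _
      refine ⟨V', chainEval_iff_mem_of_box hT hx (fun p => ?_) fun φ ih => ?_⟩
      · simp only [V', Function.update_self]
      have hb : ChainEval V' (box φ) (m + 1) ↔ φ ∈ x ∧ box φ ∈ y := by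
        rw [← ih, ← hV, ← chainEval_congr (box φ) hVV']
        refine ⟨fun h => ⟨h _ le_rfl, fun i hi => h i (by omega)⟩, fun h i hi => ?_⟩
        rcases hi.eq_or_lt with rfl | hi
        · exact h.1
        · exact h.2 i (by omega)
      rw [hb]
      refine ⟨fun ⟨hφ, hφy⟩ => ?_, fun h => ⟨CanAcc.refl hT hA hx φ h, hxy.box_mem hT h4 hx h⟩⟩
      by_contra hn
      obtain ⟨z, hz, hxz, hzc⟩ := hx.exists_cluster_notMem hT h4 hG hn
      by_cases hzx : CanAcc z x
      · exact hzc x hx hzx hxz hφ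
      · exact hzc z hz (CanAcc.refl hT hA hz) (CanAcc.refl hT hA hz)
          (hsucc z hz hxz hzx φ hφy)
    · push Not at hne
      exact ⟨_, chainEval_iff_mem_of_last hT hA h4 hG hx hne (m + 1)⟩

end Grz3

theorem mem_theoryGrz3J_iff (m : ℕ) (φ : PropModal) :
    φ ∈ theoryGrz3J (m + 1) ↔ ∀ V, ChainEval V φ m := by
  refine ⟨fun h V => theoryGrz3J_subset_chainLogic m h V m le_rfl, fun h => ?_⟩
  by_contra hφ
  have hT : IsNormal (theoryGrz3J (m + 1)) := isNormal_normalClosure _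
  have hA : axT ∈ theoryGrz3J (m + 1) :=
    theoryS4_subset_theoryGrz3J _ (subset_normalClosure _ (by simp))
  have h4 : ax4 ∈ theoryGrz3J (m + 1) :=
    theoryS4_subset_theoryGrz3J _ (subset_normalClosure _ (by simp))
  have h3 : axDot3 ∈ theoryGrz3J (m + 1) :=
    theoryS43_subset_theoryGrz3J _ (subset_normalClosure _ (by simp))
  have hG : axGrz ∈ theoryGrz3J (m + 1) :=
    theoryGrz3_subset_theoryGrz3J _ (subset_normalClosure _ (by simp))
  have hJ : axJ (m + 1) ∈ theoryGrz3J (m + 1) := subset_normalClosure _ (by simp)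
  have hd : ¬ Deriv (theoryGrz3J (m + 1)) ∅ φ := fun hd => hφ <| by
    clear hφ h
    induction hd with
    | thm h => exact h
    | hyp h => exact h.elim
    | mp _ _ ih ih' => exact hT.modusPonens _ _ ih ih'
  obtain ⟨x, hx, -, hφx⟩ := exists_isMaximalTheory hT hd
  obtain ⟨V, hV⟩ := exists_valuation hT hA h4 h3 hG hJ m hx
    fun s => hx.subset (hT.substitution s _ hJ)
  exact hφx ((hV φ).1 (h V))

end PropModal

/-! ### Sets and surjections -/

open FirstOrder Language

attribute [local instance] Language.emptyStructure

/-- Satisfaction in the category of sets and surjections, with a type instead of a world of the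
category as an argument. -/
def SetSat {α : Type} {n : ℕ} (φ : ModalFormula Language.empty α n) (W : Type u) (v : α → W)
    (xs : Fin n → W) : Prop :=
  setsSurj.{u}.Sat φ W v xs

/-- Truth of a sentence in the category of sets and surjections, with a type instead of a world of
the category as an argument. -/
def SetTruth (W : Type u) (φ : ModalSentence Language.empty) : Prop := setsSurj.{u}.Truth W φ

theorem setTruth_iff_setSat (W : Type u) (φ : ModalSentence Language.empty) (v : Empty → W)
    (xs : Fin 0 → W) : SetTruth W φ ↔ SetSat φ W v xs := by
  rw [Subsingleton.elim v Empty.elim, Subsingleton.elim xs Fin.elim0]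
  rfl

/-- A function as a homomorphism of structures for the language of equality. -/
def surjHom {W U : setsSurj.{u}.World} (f : setsSurj.{u}.carrier W → setsSurj.{u}.carrier U) :
    setsSurj.{u}.carrier W →[Language.empty] setsSurj.{u}.carrier U where
  toFun := f
  map_fun' F := nomatch F
  map_rel' R := nomatch R

theorem setSat_box_iff {α : Type} {n : ℕ} (φ : ModalFormula Language.empty α n) (W : Type u)
    (v : α → W) (xs : Fin n → W) :
    SetSat φ.box W v xs ↔ ∀ (U : Type u) (f : W → U), Function.Surjective f →
      SetSat φ U (f ∘ v) (f ∘ xs) :=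
  ⟨fun h U f hf => h U (surjHom f) hf, fun h U f hf => h U f hf⟩

theorem setSat_dia_iff {α : Type} {n : ℕ} (φ : ModalFormula Language.empty α n) (W : Type u)
    (v : α → W) (xs : Fin n → W) :
    SetSat φ.dia W v xs ↔ ∃ (U : Type u) (f : W → U), Function.Surjective f ∧
      SetSat φ U (f ∘ v) (f ∘ xs) :=
  ⟨fun ⟨U, f, hf, h⟩ => ⟨U, f, hf, h⟩, fun ⟨U, f, hf, h⟩ => ⟨U, surjHom f, hf, h⟩⟩

/-- Terms of the language of equality are variables, so every function commutes with realization. -/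
theorem realize_comp_of_empty {α : Type} {W U : Type u} (f : W → U) (t : Language.empty.Term α)
    (v : α → W) : t.realize (f ∘ v) = f (t.realize v) := by
  cases t with
  | var i => rfl
  | func F ts => exact nomatch F

/-- Satisfaction is invariant under bijections. -/
theorem setSat_comp_equiv {α : Type} {n : ℕ} (φ : ModalFormula Language.empty α n) {W U : Type u}
    (e : W ≃ U) (v : α → W) (xs : Fin n → W) :
    SetSat φ U (e ∘ v) (e ∘ xs) ↔ SetSat φ W v xs := by
  induction φ generalizing W U with
  | falsum => rfl
  | equal t₁ t₂ =>
    change t₁.realize (Sum.elim (e ∘ v) (e ∘ xs)) = t₂.realize (Sum.elim (e ∘ v) (e ∘ xs)) ↔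
      t₁.realize (Sum.elim v xs) = t₂.realize (Sum.elim v xs)
    rw [← Sum.comp_elim, realize_comp_of_empty, realize_comp_of_empty, e.injective.eq_iff]
  | rel R ts => exact nomatch R
  | imp φ ψ ihφ ihψ => exact imp_congr (ihφ e v xs) (ihψ e v xs)
  | all φ ih =>
    change (∀ b : U, SetSat φ U (e ∘ v) (Fin.snoc (e ∘ xs) b)) ↔
      ∀ a : W, SetSat φ W v (Fin.snoc xs a)
    rw [← e.forall_congr_right]
    refine forall_congr' fun a => ?_
    rw [← ih e, Fin.comp_snoc]
  | box φ ih =>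
    rw [setSat_box_iff, setSat_box_iff]
    refine ⟨fun h X f hf => ?_, fun h X f hf => h X (f ∘ e) (hf.comp e.surjective)⟩
    have := h X (f ∘ e.symm) (hf.comp e.symm.surjective)
    simpa only [← Function.comp_assoc, Function.comp_assoc f, Equiv.symm_comp_self,
      Function.comp_id] using this
  | dia φ ih =>
    rw [setSat_dia_iff, setSat_dia_iff]
    refine ⟨fun ⟨X, f, hf, h⟩ => ⟨X, f ∘ e, hf.comp e.surjective, h⟩,
      fun ⟨X, f, hf, h⟩ => ⟨X, f ∘ e.symm, hf.comp e.symm.surjective, ?_⟩⟩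
    simpa only [← Function.comp_assoc, Function.comp_assoc f, Equiv.symm_comp_self,
      Function.comp_id] using h

theorem setTruth_congr (φ : ModalSentence Language.empty) {W U : Type u} (e : W ≃ U) :
    SetTruth W φ ↔ SetTruth U φ := by
  rw [setTruth_iff_setSat W φ Empty.elim Fin.elim0, ← setSat_comp_equiv φ e,
    ← setTruth_iff_setSat]

theorem setTruth_box_iff (φ : ModalSentence Language.empty) (W : Type u) :
    SetTruth W φ.box ↔ ∀ (U : Type u) (f : W → U), Function.Surjective f → SetTruth U φ := by
  rw [setTruth_iff_setSat W _ Empty.elim Fin.elim0, setSat_box_iff]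
  simp only [← setTruth_iff_setSat]

theorem setTruth_dia_iff (φ : ModalSentence Language.empty) (W : Type u) :
    SetTruth W φ.dia ↔ ∃ (U : Type u) (f : W → U), Function.Surjective f ∧ SetTruth U φ := by
  rw [setTruth_iff_setSat W _ Empty.elim Fin.elim0, setSat_dia_iff]
  simp only [← setTruth_iff_setSat]

theorem exists_card_le_of_surjective {W U : Type u} {j : ℕ} (hW : Nat.card W = j + 1) {f : W → U}
    (hf : Function.Surjective f) : ∃ i ≤ j, Nat.card U = i + 1 := by
  have : Finite W := Nat.finite_of_card_ne_zero (by omega)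
  have : Finite U := Finite.of_surjective f hf
  have hne : Nonempty W := (Nat.card_pos_iff.1 (by omega : 0 < Nat.card W)).1
  have : Nonempty U := hne.map f
  have := Nat.card_pos (α := U)
  have := Nat.card_le_card_of_surjective f hf
  exact ⟨Nat.card U - 1, by omega, by omega⟩

theorem exists_surjective_of_card_le {W : Type u} {i j : ℕ} (hW : Nat.card W = j + 1)
    (h : i ≤ j) : ∃ f : W → ULift.{u} (Fin (i + 1)), Function.Surjective f := by
  have : Finite W := Nat.finite_of_card_ne_zero (by omega)
  let e : W ≃ Fin (j + 1) := Finite.equivFinOfCardEq hW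
  refine ⟨fun w => ⟨Fin.ofNat (i + 1) (e w)⟩, fun ⟨a⟩ => ⟨e.symm ⟨a, by omega⟩, ?_⟩⟩
  ext
  simp

/-- A set with `j + 1` elements behaves like the world `j` of the chain. -/
theorem setTruth_instantiate_iff (ψ : ℕ → ModalSentence Language.empty) (φ : PropModal)
    {V : ℕ → ℕ → Prop} {j : ℕ}
    (hV : ∀ i ≤ j, ∀ U : Type u, Nat.card U = i + 1 → ∀ p, SetTruth U (ψ p) ↔ V i p)
    {W : Type u} (hW : Nat.card W = j + 1) :
    SetTruth W (φ.instantiate ψ) ↔ φ.ChainEval V j := by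
  induction φ generalizing j W with
  | var p => exact hV j le_rfl W hW p
  | bot => rfl
  | imp φ χ ihφ ihχ => exact imp_congr (ihφ hV hW) (ihχ hV hW)
  | box φ ih =>
    refine (setTruth_box_iff _ W).trans ⟨fun h i hi => ?_, fun h U f hf => ?_⟩
    · obtain ⟨f, hf⟩ := exists_surjective_of_card_le hW hi
      exact (ih (fun k hk => hV k (hk.trans hi)) (by simp)).1 (h _ f hf)
    · obtain ⟨i, hi, hU⟩ := exists_card_le_of_surjective hW hf
      exact (ih (fun k hk => hV k (hk.trans hi)) hU).2 (h i hi)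
  | dia φ ih =>
    refine (setTruth_dia_iff _ W).trans ⟨fun ⟨U, f, hf, h⟩ => ?_, fun ⟨i, hi, h⟩ => ?_⟩
    · obtain ⟨i, hi, hU⟩ := exists_card_le_of_surjective hW hf
      exact ⟨i, hi, (ih (fun k hk => hV k (hk.trans hi)) hU).1 h⟩
    · obtain ⟨f, hf⟩ := exists_surjective_of_card_le hW hi
      exact ⟨_, f, hf, (ih (fun k hk => hV k (hk.trans hi)) (by simp)).2 h⟩

/-! ### Sentences of the language of equality -/

theorem setSat_ofFormula_iff {α : Type} {n : ℕ} (φ : Language.empty.BoundedFormula α n)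
    (W : Type u) (v : α → W) (xs : Fin n → W) :
    SetSat (ModalFormula.ofFormula φ) W v xs ↔ φ.Realize v xs := by
  induction φ with
  | falsum => rfl
  | equal t₁ t₂ => rfl
  | rel R ts => exact nomatch R
  | imp φ ψ ihφ ihψ => exact imp_congr (ihφ xs) (ihψ xs)
  | all φ ih => exact forall_congr' fun a => ih (Fin.snoc xs a)

theorem setTruth_ofFormula_iff (φ : Language.empty.Sentence) (W : Type u) :
    SetTruth W (ModalFormula.ofFormula φ) ↔ W ⊨ φ := by
  rw [setTruth_iff_setSat W _ default default, setSat_ofFormula_iff]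
  rfl

/-- Any set of finite cardinalities is defined, below a given bound, by a sentence of the language of
equality. -/
theorem exists_sentence_of_card (P : ℕ → Prop) (m : ℕ) :
    ∃ θ : Language.empty.Sentence, ∀ j < m, ∀ U : Type u, Nat.card U = j + 1 →
      (U ⊨ θ ↔ P j) := by
  induction m with
  | zero => exact ⟨⊥, fun j hj => absurd hj (Nat.not_lt_zero j)⟩
  | succ m ih =>
    obtain ⟨θ, hθ⟩ := ih
    have hge : ∀ j, ∀ U : Type u, Nat.card U = j + 1 →
        (U ⊨ Sentence.cardGe Language.empty (m + 1) ↔ m ≤ j) := fun j U hU => by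
      have : Finite U := Nat.finite_of_card_ne_zero (by omega)
      rw [Sentence.realize_cardGe, ← Nat.cast_card, hU, Nat.cast_le]
      omega
    by_cases hP : P m
    -- In both cases `θ` decides the sets with at most `m` elements, the other sentence those with more.
    · refine ⟨θ ⊔ Sentence.cardGe Language.empty (m + 1), fun j hj U hU => ?_⟩
      refine Formula.realize_sup.trans ((or_congr Iff.rfl (hge j U hU)).trans ?_)
      rcases (Nat.lt_succ_iff.1 hj).eq_or_lt with rfl | hlt
      · simp [hP]
      · exact (or_iff_left hlt.not_ge).trans (hθ j hlt U hU)
    · refine ⟨θ ⊓ (Sentence.cardGe Language.empty (m + 1)).not, fun j hj U hU => ?_⟩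
      refine Formula.realize_inf.trans
        ((and_congr Iff.rfl (Formula.realize_not.trans (not_congr (hge j U hU)))).trans ?_)
      rcases (Nat.lt_succ_iff.1 hj).eq_or_lt with rfl | hlt
      · simp [hP]
      · exact (and_iff_left hlt.not_ge).trans (hθ j hlt U hU)

theorem mainTheorem3 (n : ℕ) (hn : 0 < n) (W : Type u) (hW : Cardinal.mk W = (n : Cardinal.{u}))
    (S : SubstLanguage FirstOrder.Language.empty)
    (hS₁ : SubstLanguage.nonmodal FirstOrder.Language.empty ≤ S)
    (hS₂ : S ≤ SubstLanguage.modal FirstOrder.Language.empty) :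
    (setsSurj.{u}).sententialVal W S = PropModal.theoryGrz3J n := by
  obtain ⟨m, rfl⟩ := Nat.exists_eq_succ_of_ne_zero hn.ne'
  have hW' : Nat.card W = m + 1 := by simp [Nat.card, hW]
  ext φ
  rw [PropModal.mem_theoryGrz3J_iff]
  refine ⟨fun h V => ?_, fun h ψ _ => ?_⟩
  -- A valuation is realized by non-modal sentences, and sentences from `S` induce a valuation.
  · choose θ hθ using fun p => exists_sentence_of_card.{u} (fun j => V j p) (m + 1)
    refine (setTruth_instantiate_iff (fun p => .ofFormula (θ p)) φ (fun i hi U hU p => ?_) hW').1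
      (h _ fun p => hS₁ 0 ⟨θ p, rfl⟩)
    rw [setTruth_ofFormula_iff, hθ p i (Nat.lt_succ_of_le hi) U hU]
  · refine (setTruth_instantiate_iff ψ φ (V := fun i p =>
      SetTruth (ULift.{u} (Fin (i + 1))) (ψ p)) (fun i _ U hU p => ?_) hW').2 (h _)
    have : Finite U := Nat.finite_of_card_ne_zero (by omega)
    exact setTruth_congr (ψ p) ((Finite.equivFinOfCardEq hU).trans Equiv.ulift.symm)
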